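/- Let $R$ be a commutative ring with identity. All graphs are simple (undirected, without loops or multiple edges). For graphs $G,H$, a graph map $G\to H$ is a map $V(G)\to V(H)$ sending the two ends of every edge to equal or adjacent vertices. Let $Q_d$ ($d\ge 0$) be the graph on $\{0,1\}^d$ in which two vertices are adjacent if and only if they differ in exactly one position. A singular $d$-cube on $G$ is a graph map $\sigma:Q_d\to G$; for $d\ge 1$ and $1\le i\le d$ its faces $f_i^{+}\sigma$ and $f_i^{-}\sigma$ are the singular $(d-1)$-cubes obtained by setting the $i$-th coordinate to $1$ and to $0$, and $\sigma$ is degenerate if $f_i^+\sigma=f_i^-\sigma$ for some $i$ (no $0$-cube is degenerate). Let $\mathcal C_d(G)$ be the free $R$-module on all singular $d$-cubes modulo the submodule generated by the degenerate ones, with boundary $\partial_d\sigma=\sum_{i=1}^d(-1)^i(f_i^-\sigma-f_i^+\sigma)$ for $d\ge1$ and $\partial_0=0$, and let $\mathcal H_d^{\mathrm{Cube}}(G)=\ker\partial_d/\operatorname{im}\partial_{d+1}$ for $d\ge 0$. For an integer $N\ge 1$ let $I_N$ be the path with vertices $0,1,\dots,N$, and let $G^{\times N}$ be the graph obtained from the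 Cartesian product $G\,\Box\,I_N$ by identifying all vertices of $V(G)\times\{0\}$ with one another and all vertices of $V(G)\times\{N\}$ with one another; two distinct classes are adjacent if and only if they have adjacent representatives. Put $G_1=G$ and $G_{d+1}=G_d^{\times(d+3)}$ for $d\ge1$. **Theorem.** For every graph $G$ and every $d\ge1$ there is an isomorphism of $R$-modules $$\mathcal H_{d+1}^{\mathrm{Cube}}(G_{d+1})\cong\mathcal H_d^{\mathrm{Cube}}(G_d).$$ Moreover, suppose $R\neq0$, and let $G_1=\mathbb Z_5$ be the $5$-cycle. Then $\mathcal H_d^{\mathrm{Cube}}(G_d)\neq0$ for every $d\ge1$; also $\mathcal H_0^{\mathrm{Cube}}(\mathbb Z_5)\ne0$, so that nonvanishing cubical homology occurs in every dimension. -/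

import Mathlib

open CategoryTheory

universe u v

/-- The discrete `d`-cube `Q_d`: its vertices are the `0/1`-vectors of length `d` (`false` is `0`,
`true` is `1`), and two vertices are adjacent when they differ in exactly one position. -/
def discreteCube (d : ℕ) : SimpleGraph (Fin d → Bool) where
  Adj a b := ∃! i, a i ≠ b i
  symm := ⟨fun _ _ h => by simpa only [ne_comm] using h⟩
  loopless := ⟨fun _ h => by obtain ⟨i, hi, -⟩ := h; exact hi rfl⟩

/-- A graph map between simple graphs: the end points of an edge are sent to equal or to adjacent
vertices. -/
def IsGraphMap {V : Type*} {W : Type*} (G : SimpleGraph V) (H : SimpleGraph W) (f : V → W) : Prop :=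
  ∀ a b, G.Adj a b → f a = f b ∨ H.Adj (f a) (f b)

/-- The singular `d`-cubes on `G`: graph maps from `Q_d` to `G`. -/
@[ext]
structure SingularCube {V : Type u} (G : SimpleGraph V) (d : ℕ) : Type u where
  toFun : (Fin d → Bool) → V
  isGraphMap : IsGraphMap (discreteCube d) G toFun

namespace SingularCube

variable {V : Type u} {G : SimpleGraph V} {d : ℕ}

theorem adj_insertNth (i : Fin (d + 1)) (e : Bool) {a b : Fin d → Bool}
    (h : (discreteCube d).Adj a b) :
    (discreteCube (d + 1)).Adj (i.insertNth e a) (i.insertNth e b) := by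
  obtain ⟨j, hj, hu⟩ := h
  refine ⟨i.succAbove j, by simpa using hj, fun k hk => ?_⟩
  induction k using i.succAboveCases with
  | x => simp at hk
  | p k =>
    rw [hu k (by simpa using hk)]

/-- The face of a singular cube obtained by setting the `i`-th coordinate (counted from `0`) to
`e`: `e = true` gives `f_{i+1}^+`, and `e = false` gives `f_{i+1}^-`. -/
def face (σ : SingularCube G (d + 1)) (i : Fin (d + 1)) (e : Bool) : SingularCube G d where
  toFun a := σ.toFun (i.insertNth e a)
  isGraphMap _ _ h := σ.isGraphMap _ _ (adj_insertNth i e h)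

/-- A singular cube is degenerate if its two opposite faces in some direction coincide; no
`0`-cube is degenerate. -/
def IsDegenerate : {d : ℕ} → SingularCube G d → Prop
  | 0, _ => False
  | _ + 1, σ => ∃ i, σ.face i true = σ.face i false

theorem insertNth_insertNth (i : Fin (d + 2)) (j : Fin (d + 1)) (e f : Bool) (a : Fin d → Bool) :
    (i.insertNth e (j.insertNth f a : Fin (d + 1) → Bool) : Fin (d + 2) → Bool) =
      (i.succAbove j).insertNth f ((j.predAbove i).insertNth e a : Fin (d + 1) → Bool) := by
  rw [Fin.insertNth_eq_iff]
  constructor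
  · have h := Fin.insertNth_apply_succAbove (α := fun _ => Bool) (i.succAbove j) f
      ((j.predAbove i).insertNth e a : Fin (d + 1) → Bool) (j.predAbove i)
    rw [Fin.succAbove_succAbove_predAbove] at h
    rw [h]
    simp
  · funext k
    induction k using j.succAboveCases with
    | x => simp [Fin.removeNth]
    | p k =>
      simp only [Fin.insertNth_apply_succAbove, Fin.removeNth]
      rw [← Fin.succAbove_succAbove_succAbove_predAbove i j k]
      simp

theorem face_face (σ : SingularCube G (d + 2)) (i : Fin (d + 2)) (j : Fin (d + 1)) (e f : Bool) :
    (σ.face i e).face j f = (σ.face (i.succAbove j) f).face (j.predAbove i) e := by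
  ext a
  simp only [face, insertNth_insertNth i j e f a]

theorem IsDegenerate.face_of_ne {σ : SingularCube G (d + 1)} {i k : Fin (d + 1)}
    (hi : σ.face i true = σ.face i false) (hk : k ≠ i) (e : Bool) :
    (σ.face k e).IsDegenerate := by
  cases d with
  | zero => omega
  | succ d =>
    obtain ⟨j, rfl⟩ := Fin.exists_succAbove_eq hk.symm
    exact ⟨j, by rw [face_face σ k j, face_face σ k j, hi]⟩

end SingularCube

section Chains

variable (R : Type v) [CommRing R] {V : Type u} (G : SimpleGraph V)

/-- `L_d(G)`: the free `R`-module on all singular `d`-cubes. -/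
noncomputable abbrev FreeCubeChains (d : ℕ) : Type max u v := SingularCube G d →₀ R

/-- `D_d(G)`: the submodule of `L_d(G)` generated by the degenerate singular `d`-cubes. -/
noncomputable def degenerateCubeChains (d : ℕ) : Submodule R (FreeCubeChains R G d) :=
  Submodule.span R {x | ∃ σ : SingularCube G d, σ.IsDegenerate ∧ x = Finsupp.single σ 1}

/-- `C_d(G) = L_d(G) / D_d(G)`: the module of cubical `d`-chains. -/
noncomputable abbrev CubeChains (d : ℕ) : Type max u v := FreeCubeChains R G d ⧸ degenerateCubeChains R G d

/-- The boundary map `L_{d+1}(G) → L_d(G)`, which sends a singular cube `σ` to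
`∑_{i=1}^{d+1} (-1)^i (f_i^- σ - f_i^+ σ)`. The directions are counted from `0` here. -/
noncomputable def freeCubeBoundary (d : ℕ) : FreeCubeChains R G (d + 1) →ₗ[R] FreeCubeChains R G d :=
  Finsupp.lift (FreeCubeChains R G d) R (SingularCube G (d + 1)) fun σ =>
    ∑ i : Fin (d + 1), (-1 : R) ^ ((i : ℕ) + 1) •
      (Finsupp.single (σ.face i false) 1 - Finsupp.single (σ.face i true) 1)

variable {G} in
theorem freeCubeBoundary_single (d : ℕ) (σ : SingularCube G (d + 1)) :
    freeCubeBoundary R G d (Finsupp.single σ 1) =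
      ∑ i : Fin (d + 1), (-1 : R) ^ ((i : ℕ) + 1) •
        (Finsupp.single (σ.face i false) 1 - Finsupp.single (σ.face i true) 1) := by
  simp [freeCubeBoundary]

theorem freeCubeBoundary_degenerate (d : ℕ) :
    degenerateCubeChains R G (d + 1) ≤
      (degenerateCubeChains R G d).comap (freeCubeBoundary R G d) := by
  refine Submodule.span_le.2 ?_
  rintro _ ⟨σ, ⟨i, hi⟩, rfl⟩
  simp only [Submodule.comap_coe, Set.mem_preimage, SetLike.mem_coe, freeCubeBoundary_single]
  refine Submodule.sum_mem _ fun k _ => Submodule.smul_mem _ _ ?_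
  by_cases hk : k = i
  · subst hk
    simp [hi]
  · exact Submodule.sub_mem _
      (Submodule.subset_span ⟨_, SingularCube.IsDegenerate.face_of_ne hi hk _, rfl⟩)
      (Submodule.subset_span ⟨_, SingularCube.IsDegenerate.face_of_ne hi hk _, rfl⟩)

theorem neg_one_pow_succAbove_predAbove {d : ℕ} (i : Fin (d + 2)) (j : Fin (d + 1)) :
    (-1 : R) ^ ((i.succAbove j : ℕ) + 1) * (-1) ^ ((j.predAbove i : ℕ) + 1) =
      -((-1) ^ ((i : ℕ) + 1) * (-1) ^ ((j : ℕ) + 1)) := by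
  rcases lt_or_ge j.castSucc i with h | h
  · obtain ⟨i, rfl⟩ := Fin.exists_succ_eq.2 (Fin.ne_zero_of_lt h)
    rw [Fin.succAbove_of_castSucc_lt _ _ h, Fin.predAbove_of_castSucc_lt _ _ h]
    simp [pow_succ]
    ring
  · obtain ⟨i, rfl⟩ := Fin.exists_castSucc_eq.2 (Fin.ne_last_of_lt (lt_of_le_of_lt h j.castSucc_lt_last))
    rw [Fin.succAbove_of_le_castSucc _ _ h, Fin.predAbove_of_le_castSucc _ _ h]
    simp [pow_succ]
    ring

theorem freeCubeBoundary_comp (d : ℕ) :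
    freeCubeBoundary R G d ∘ₗ freeCubeBoundary R G (d + 1) = 0 := by
  refine Finsupp.lhom_ext' fun σ => LinearMap.ext_ring ?_
  simp only [LinearMap.comp_apply, Finsupp.lsingle_apply, freeCubeBoundary_single, map_sum,
    map_smul, map_sub, LinearMap.zero_apply, ← Finset.sum_sub_distrib, Finset.smul_sum]
  rw [← Finset.sum_product']
  refine Finset.sum_involution (fun p _ => (p.1.succAbove p.2, p.2.predAbove p.1)) ?_ ?_ ?_ ?_
  · rintro ⟨i, j⟩ -
    simp only [← smul_sub, smul_smul, neg_one_pow_succAbove_predAbove, neg_smul]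
    rw [← sub_eq_add_neg, ← smul_sub]
    simp only [σ.face_face i j]
    rw [sub_eq_zero.2 (by abel), smul_zero]
  · rintro ⟨i, j⟩ - - h
    exact Fin.succAbove_ne i j (congrArg Prod.fst h)
  · simp
  · rintro ⟨i, j⟩ -
    simp [Fin.succAbove_succAbove_predAbove, Fin.predAbove_predAbove_succAbove]

/-- The boundary map `C_{d+1}(G) → C_d(G)` induced on the quotients. -/
noncomputable def cubeBoundary (d : ℕ) : CubeChains R G (d + 1) →ₗ[R] CubeChains R G d :=
  Submodule.mapQ _ _ (freeCubeBoundary R G d) (freeCubeBoundary_degenerate R G d)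

theorem cubeBoundary_comp (d : ℕ) : cubeBoundary R G d ∘ₗ cubeBoundary R G (d + 1) = 0 := by
  refine Submodule.linearMap_qext _ (LinearMap.ext fun x => ?_)
  simpa [cubeBoundary] using
    congrArg (Submodule.mkQ (degenerateCubeChains R G d))
      (LinearMap.congr_fun (freeCubeBoundary_comp R G d) x)

/-- The cubical chain complex `C(G)` of `R`-modules, concentrated in degrees `d ≥ 0`. -/
noncomputable def cubeComplex : ChainComplex (ModuleCat.{max u v} R) ℕ :=
  ChainComplex.of (fun d => ModuleCat.of R (CubeChains R G d))
    (fun d => ModuleCat.ofHom (cubeBoundary R G d))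
    (fun d => by rw [← ModuleCat.ofHom_comp, cubeBoundary_comp]; rfl)

/-- The discrete cubical homology `H_d^Cube(G)` with coefficients in `R`. -/
noncomputable abbrev cubeHomology (d : ℕ) : ModuleCat.{max u v} R := (cubeComplex R G).homology d

end Chains

section Suspension

/-- The equivalence relation on `V × {0, …, N}` that identifies all the points of `V × {0}` with
one another, and all the points of `V × {N}` with one another. -/
def endsSetoid (V : Type u) (N : ℕ) : Setoid (V × Fin (N + 1)) where
  r p q := p = q ∨ (p.2 = 0 ∧ q.2 = 0) ∨ (p.2 = Fin.last N ∧ q.2 = Fin.last N)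
  iseqv := ⟨fun _ => Or.inl rfl, by grind, by grind⟩

/-- The graph `G^{×N} = (G □ I_N) / ∼`, where `I_N` is the path on `{0, …, N}`: two distinct
classes are adjacent when they have adjacent representatives. -/
def suspensionGraph {V : Type u} (G : SimpleGraph V) (N : ℕ) :
    SimpleGraph (Quotient (endsSetoid V N)) :=
  (G.boxProd (SimpleGraph.pathGraph (N + 1))).map (Quotient.mk (endsSetoid V N))

/-- The sequence `G_1 = G`, `G_{d+1} = G_d^{×(d+3)}` for `d ≥ 1`, each graph together with its
vertex type. The sequence starts at `d = 1`; the value at `d = 0` is a placeholder. -/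
def graphSeq {V : Type u} (G : SimpleGraph V) : ℕ → (W : Type u) × SimpleGraph W
  | 0 => ⟨V, G⟩
  | 1 => ⟨V, G⟩
  | d + 2 => ⟨_, suspensionGraph (graphSeq G (d + 1)).2 ((d + 1) + 3)⟩

end Suspension

/-! The reason is a Mayer-Vietoris argument that needs no subdivision. Height in the suspension
changes by at most 1 along an edge, so a `k`-cube spans at most `k` levels. Homology in degree `d +
2` involves only cubes of dimension at most `d + 3`. With `N ≥ d + 4` none of these meets both
poles, and each lies in the part `S` of positive height or the part `T` of height below `N`
(`nonempty_cubeHomology_suspension_equiv`).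

Each of `S` and `T` contracts to its pole by pushing heights one level at a time, and `S ∩ T`
deformation retracts onto a copy of the base graph at height 1. Close graph maps are chain homotopic
through prisms, so `S` and `T` are acyclic in positive degrees. The connecting map `z ↦ ∂(z_S)`,
where `z_S` is the part of `z` in `S`, then gives the isomorphism
(`nonempty_cubeHomology_equiv_inter`).

For nonvanishing it remains to treat the pentagon in degree 1. Winding number is a cocycle there,
because the pentagon has no 3- or 4-cycles, and it takes the value 1 on the cycle of the five edges.
In degree 0 the augmentation suffices. -/

section ChainTools

variable (R : Type v) [CommRing R] {V : Type u} {G : SimpleGraph V}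

/-- The class in `C_d(G)` of a singular cube. -/
noncomputable def chainOf {d : ℕ} (σ : SingularCube G d) : CubeChains R G d :=
  Submodule.Quotient.mk (Finsupp.single σ 1)

variable {R} in
theorem chainOf_eq_zero {d : ℕ} {σ : SingularCube G d} (h : σ.IsDegenerate) :
    chainOf R σ = 0 :=
  (Submodule.Quotient.mk_eq_zero _).2 (Submodule.subset_span ⟨σ, h, rfl⟩)

variable {R} in
theorem CubeChains.hom_ext {d : ℕ} {M : Type*} [AddCommGroup M] [Module R M]
    {f g : CubeChains R G d →ₗ[R] M} (h : ∀ σ, f (chainOf R σ) = g (chainOf R σ)) : f = g := by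
  refine Submodule.linearMap_qext _ (Finsupp.lhom_ext' fun σ => LinearMap.ext_ring ?_)
  exact h σ

/-- The linear map on `C_d(G)` induced by a function on singular cubes that vanishes on the
degenerate ones. -/
noncomputable def liftChain {d : ℕ} {M : Type*} [AddCommGroup M] [Module R M]
    (φ : SingularCube G d → M) (hφ : ∀ σ, σ.IsDegenerate → φ σ = 0) : CubeChains R G d →ₗ[R] M :=
  (degenerateCubeChains R G d).liftQ (Finsupp.lift M R _ φ) <| by
    refine Submodule.span_le.2 ?_
    rintro _ ⟨σ, hσ, rfl⟩
    simpa using hφ σ hσ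

@[simp]
theorem liftChain_chainOf {d : ℕ} {M : Type*} [AddCommGroup M] [Module R M]
    (φ : SingularCube G d → M) (hφ : ∀ σ, σ.IsDegenerate → φ σ = 0) (σ : SingularCube G d) :
    liftChain R φ hφ (chainOf R σ) = φ σ :=
  (Submodule.liftQ_apply _ _ _).trans (by simp)

theorem cubeBoundary_chainOf {d : ℕ} (σ : SingularCube G (d + 1)) :
    cubeBoundary R G d (chainOf R σ) = ∑ i : Fin (d + 1), (-1 : R) ^ ((i : ℕ) + 1) •
      (chainOf R (σ.face i false) - chainOf R (σ.face i true)) := by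
  have h := congrArg (Submodule.mkQ (degenerateCubeChains R G d)) (freeCubeBoundary_single R d σ)
  simpa [cubeBoundary, chainOf] using h

variable (G) in
@[simp]
theorem cubeBoundary_cubeBoundary {d : ℕ} (x : CubeChains R G (d + 2)) :
    cubeBoundary R G d (cubeBoundary R G (d + 1) x) = 0 :=
  LinearMap.congr_fun (cubeBoundary_comp R G d) x

end ChainTools

/-! ### Chain maps induced by graph maps -/

section Functoriality

variable (R : Type v) [CommRing R] {V W : Type u} {G : SimpleGraph V} {H : SimpleGraph W}

theorem SingularCube.isGraphMap_comp {f : V → W} (hf : IsGraphMap G H f) {d : ℕ}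
    (σ : SingularCube G d) : IsGraphMap (discreteCube d) H (f ∘ σ.toFun) := by
  intro a b h
  rcases σ.isGraphMap a b h with h | h
  · exact Or.inl (congrArg f h)
  · exact hf _ _ h

/-- The image of a singular cube under a graph map. -/
def SingularCube.map {f : V → W} (hf : IsGraphMap G H f) {d : ℕ} (σ : SingularCube G d) :
    SingularCube H d :=
  ⟨f ∘ σ.toFun, σ.isGraphMap_comp hf⟩

theorem SingularCube.map_face {f : V → W} (hf : IsGraphMap G H f) {d : ℕ}
    (σ : SingularCube G (d + 1)) (i : Fin (d + 1)) (e : Bool) :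
    (σ.map hf).face i e = (σ.face i e).map hf := rfl

theorem SingularCube.IsDegenerate.map {f : V → W} (hf : IsGraphMap G H f) {d : ℕ}
    {σ : SingularCube G d} (h : σ.IsDegenerate) : (σ.map hf).IsDegenerate := by
  cases d with
  | zero => exact h
  | succ d =>
    obtain ⟨i, hi⟩ := h
    exact ⟨i, by rw [map_face, map_face, hi]⟩

/-- The map of cubical chains induced by a graph map. -/
noncomputable def cubeMap {f : V → W} (hf : IsGraphMap G H f) (d : ℕ) :
    CubeChains R G d →ₗ[R] CubeChains R H d :=
  liftChain R (fun σ => chainOf R (σ.map hf)) fun _ h => chainOf_eq_zero (h.map hf)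

@[simp]
theorem cubeMap_chainOf {f : V → W} (hf : IsGraphMap G H f) {d : ℕ} (σ : SingularCube G d) :
    cubeMap R hf d (chainOf R σ) = chainOf R (σ.map hf) := by
  simp [cubeMap]

theorem cubeBoundary_cubeMap {f : V → W} (hf : IsGraphMap G H f) {d : ℕ}
    (x : CubeChains R G (d + 1)) :
    cubeBoundary R H d (cubeMap R hf (d + 1) x) = cubeMap R hf d (cubeBoundary R G d x) := by
  refine LinearMap.congr_fun (f := cubeBoundary R H d ∘ₗ cubeMap R hf (d + 1))
    (g := cubeMap R hf d ∘ₗ cubeBoundary R G d) (CubeChains.hom_ext fun σ => ?_) x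
  simp [cubeBoundary_chainOf, SingularCube.map_face]

theorem cubeMap_id {f : V → V} (hf : IsGraphMap G G f) (h : ∀ x, f x = x) {d : ℕ}
    (x : CubeChains R G d) : cubeMap R hf d x = x := by
  obtain rfl : f = id := funext h
  refine LinearMap.congr_fun (g := LinearMap.id) (CubeChains.hom_ext fun σ => ?_) x
  simp [SingularCube.map]

theorem cubeMap_cubeMap {U : Type u} {K : SimpleGraph U} {f : V → W} {g : W → U} {k : V → U}
    (hf : IsGraphMap G H f) (hg : IsGraphMap H K g) (hk : IsGraphMap G K k)
    (h : ∀ x, g (f x) = k x) {d : ℕ} (x : CubeChains R G d) :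
    cubeMap R hg d (cubeMap R hf d x) = cubeMap R hk d x := by
  obtain rfl : g ∘ f = k := funext h
  refine LinearMap.congr_fun (f := cubeMap R hg d ∘ₗ cubeMap R hf d) (CubeChains.hom_ext fun σ => ?_) x
  simp [SingularCube.map, Function.comp_assoc]

/-- A constant cube of positive dimension is degenerate. In degree 0 this fails, since no `0`-cube
is degenerate. -/
theorem cubeMap_const {f : V → W} (hf : IsGraphMap G H f) (h : ∀ x y, f x = f y) {d : ℕ}
    (x : CubeChains R G (d + 1)) : cubeMap R hf (d + 1) x = 0 := by
  refine LinearMap.congr_fun (g := 0) (CubeChains.hom_ext fun σ => ?_) x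
  rw [cubeMap_chainOf]
  exact chainOf_eq_zero ⟨0, SingularCube.ext (funext fun a => h _ _)⟩

end Functoriality

/-! ### Homotopy invariance through prisms -/

section Homotopy

variable (R : Type v) [CommRing R] {V W : Type u} {G : SimpleGraph V} {H : SimpleGraph W}

/-- Two maps into a graph are close if they send each point to equal or adjacent vertices. -/
def CloseMaps (H : SimpleGraph W) (f g : V → W) : Prop :=
  ∀ x, f x = g x ∨ H.Adj (f x) (g x)

theorem discreteCube_adj_succ {d : ℕ} {a b : Fin (d + 1) → Bool}
    (h : (discreteCube (d + 1)).Adj a b) :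
    (a 0 ≠ b 0 ∧ Fin.tail a = Fin.tail b) ∨
      (a 0 = b 0 ∧ (discreteCube d).Adj (Fin.tail a) (Fin.tail b)) := by
  obtain ⟨i, hi, hu⟩ := h
  by_cases h0 : a 0 = b 0
  · refine Or.inr ⟨h0, ?_⟩
    obtain ⟨j, rfl⟩ := Fin.exists_succ_eq.2 (fun h => hi (h ▸ h0) : i ≠ 0)
    exact ⟨j, hi, fun k hk => Fin.succ_injective _ (hu _ hk)⟩
  · refine Or.inl ⟨h0, funext fun j => ?_⟩
    by_contra hj
    exact Fin.succ_ne_zero j ((hu _ hj).trans (hu _ h0).symm)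

/-- The prism over a singular cube `σ`: the cube with bottom `f ∘ σ` and top `g ∘ σ` in the first
direction. -/
def SingularCube.prism {f g : V → W} (hf : IsGraphMap G H f) (hg : IsGraphMap G H g)
    (hfg : CloseMaps H f g) {d : ℕ} (σ : SingularCube G d) : SingularCube H (d + 1) where
  toFun a := if a 0 then g (σ.toFun (Fin.tail a)) else f (σ.toFun (Fin.tail a))
  isGraphMap a b h := by
    beta_reduce
    rcases discreteCube_adj_succ h with ⟨h0, ht⟩ | ⟨h0, ht⟩
    · rw [ht]
      have h1 := hfg (σ.toFun (Fin.tail b))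
      have h2 := h1.imp Eq.symm SimpleGraph.Adj.symm
      cases ha : a 0 <;> cases hb : b 0 <;> simp_all
    · rw [h0]
      split_ifs
      · exact σ.isGraphMap_comp hg _ _ ht
      · exact σ.isGraphMap_comp hf _ _ ht

section

variable {f g : V → W} (hf : IsGraphMap G H f) (hg : IsGraphMap G H g) (hfg : CloseMaps H f g)

theorem SingularCube.prism_face_zero_false {d : ℕ} (σ : SingularCube G d) :
    (σ.prism hf hg hfg).face 0 false = σ.map hf := by
  ext a
  simp [prism, face, map]

theorem SingularCube.prism_face_zero_true {d : ℕ} (σ : SingularCube G d) :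
    (σ.prism hf hg hfg).face 0 true = σ.map hg := by
  ext a
  simp [prism, face, map]

theorem SingularCube.prism_face_succ {d : ℕ} (σ : SingularCube G (d + 1)) (i : Fin (d + 1))
    (e : Bool) :
    (σ.prism hf hg hfg).face i.succ e = (σ.face i e).prism hf hg hfg := by
  ext a
  have h0 : (i.succ.insertNth e a : Fin (d + 2) → Bool) 0 = a 0 := by
    have := Fin.insertNth_apply_succAbove (α := fun _ => Bool) i.succ e a 0
    rwa [Fin.succ_succAbove_zero] at this
  have ht : Fin.tail (i.succ.insertNth e a : Fin (d + 2) → Bool) = i.insertNth e (Fin.tail a) := by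
    funext k
    induction k using i.succAboveCases with
    | x => simp [Fin.tail]
    | p k =>
      have := Fin.insertNth_apply_succAbove (α := fun _ => Bool) i.succ e a k.succ
      rw [Fin.succ_succAbove_succ] at this
      simpa [Fin.tail] using this
  simp only [prism, face, h0, ht]

theorem SingularCube.IsDegenerate.prism {d : ℕ} {σ : SingularCube G d} (h : σ.IsDegenerate) :
    (σ.prism hf hg hfg).IsDegenerate := by
  cases d with
  | zero => exact h.elim
  | succ d =>
    obtain ⟨i, hi⟩ := h
    exact ⟨i.succ, by rw [prism_face_succ, prism_face_succ, hi]⟩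

/-- The chain homotopy between the chain maps of two close graph maps. -/
noncomputable def cubePrism (d : ℕ) : CubeChains R G d →ₗ[R] CubeChains R H (d + 1) :=
  liftChain R (fun σ => chainOf R (σ.prism hf hg hfg)) fun _ h => chainOf_eq_zero (h.prism hf hg hfg)

/-- The two faces in the new direction are the ends of the prism. The other faces are prisms over
the faces of `σ`, with the direction shifted by one; the shift accounts for the minus sign. -/
theorem cubeBoundary_cubePrism {d : ℕ} (x : CubeChains R G (d + 1)) :
    cubeBoundary R H (d + 1) (cubePrism R hf hg hfg (d + 1) x) =
      cubeMap R hg (d + 1) x - cubeMap R hf (d + 1) x -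
        cubePrism R hf hg hfg d (cubeBoundary R G d x) := by
  refine LinearMap.congr_fun (f := cubeBoundary R H (d + 1) ∘ₗ cubePrism R hf hg hfg (d + 1))
    (g := cubeMap R hg (d + 1) - cubeMap R hf (d + 1) -
        cubePrism R hf hg hfg d ∘ₗ cubeBoundary R G d) (CubeChains.hom_ext fun σ => ?_) x
  simp only [LinearMap.comp_apply, LinearMap.sub_apply, cubePrism, liftChain_chainOf,
    cubeMap_chainOf, cubeBoundary_chainOf, map_sum, map_smul, map_sub]
  rw [Fin.sum_univ_succ]
  simp only [SingularCube.prism_face_zero_false, SingularCube.prism_face_zero_true,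
    SingularCube.prism_face_succ, Fin.val_succ, Fin.val_zero, pow_succ, pow_zero]
  rw [sub_eq_add_neg _ (Finset.sum _ _), ← Finset.sum_neg_distrib]
  congr 1
  · simp
  · exact Finset.sum_congr rfl fun i _ => by simp [neg_smul]

end

/-- Consecutive maps differ on a cycle by the boundary of a prism; the differences telescope. -/
theorem cubeMap_sub_cubeMap_mem {F : ℕ → V → W} (hF : ∀ t, IsGraphMap G H (F t))
    (hc : ∀ t, CloseMaps H (F t) (F (t + 1))) {d : ℕ} {x : CubeChains R G (d + 1)}
    (hx : cubeBoundary R G d x = 0) (t : ℕ) :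
    cubeMap R (hF t) (d + 1) x - cubeMap R (hF 0) (d + 1) x ∈
      LinearMap.range (cubeBoundary R H (d + 1)) := by
  induction t with
  | zero => simp
  | succ t ih =>
    have h : cubeMap R (hF (t + 1)) (d + 1) x - cubeMap R (hF t) (d + 1) x ∈
        LinearMap.range (cubeBoundary R H (d + 1)) :=
      ⟨cubePrism R (hF t) (hF (t + 1)) (hc t) (d + 1) x, by
        rw [cubeBoundary_cubePrism, hx, map_zero, sub_zero]⟩
    simpa using Submodule.add_mem _ h ih

end Homotopy

/-! ### Homology as cycles modulo boundaries -/

section Homology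

variable (R : Type v) [CommRing R] {V : Type u} (G : SimpleGraph V)

theorem cubeComplex_d (d : ℕ) :
    (cubeComplex R G).d (d + 1) d = ModuleCat.ofHom (cubeBoundary R G d) := by
  simp [cubeComplex, ChainComplex.of_d]

/-- Homology in positive degree as cycles modulo boundaries. -/
noncomputable def cubeHomologyEquiv (d : ℕ) :
    cubeHomology R G (d + 1) ≃ₗ[R]
      LinearMap.ker (cubeBoundary R G d) ⧸
        LinearMap.range ((cubeBoundary R G (d + 1)).codRestrict (LinearMap.ker (cubeBoundary R G d))
          fun x => cubeBoundary_cubeBoundary R G x) := by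
  let S : ShortComplex (ModuleCat.{max u v} R) := ShortComplex.mk
    (ModuleCat.ofHom (cubeBoundary R G (d + 1))) (ModuleCat.ofHom (cubeBoundary R G d))
    (by rw [← ModuleCat.ofHom_comp, cubeBoundary_comp]; rfl)
  let e : (cubeComplex R G).sc' (d + 2) (d + 1) d ≅ S :=
    ShortComplex.isoMk (Iso.refl _) (Iso.refl _) (Iso.refl _)
      (by simp [S, cubeComplex_d]; rfl) (by simp [S, cubeComplex_d]; rfl)
  exact (((cubeComplex R G).homologyIsoSc' (d + 2) (d + 1) d (by simp) (by simp)) ≪≫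
    ShortComplex.homologyMapIso e ≪≫ S.moduleCatHomologyIso).toLinearEquiv

variable {G}

/-- `Φ` is not required to be a chain map: the connecting map is defined on all chains but behaves
well only on cycles. -/
theorem nonempty_cubeHomology_equiv {W : Type u} {H : SimpleGraph W} {k l : ℕ}
    (Φ : CubeChains R G (k + 1) →ₗ[R] CubeChains R H (l + 1))
    (hcycle : ∀ z, cubeBoundary R G k z = 0 → cubeBoundary R H l (Φ z) = 0)
    (hbdry : ∀ y, Φ (cubeBoundary R G (k + 1) y) ∈ LinearMap.range (cubeBoundary R H (l + 1)))
    (hinj : ∀ z, cubeBoundary R G k z = 0 → Φ z ∈ LinearMap.range (cubeBoundary R H (l + 1)) →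
      z ∈ LinearMap.range (cubeBoundary R G (k + 1)))
    (hsurj : ∀ c, cubeBoundary R H l c = 0 → ∃ z, cubeBoundary R G k z = 0 ∧
      Φ z - c ∈ LinearMap.range (cubeBoundary R H (l + 1))) :
    Nonempty (cubeHomology R G (k + 1) ≃ₗ[R] cubeHomology R H (l + 1)) := by
  let BG := LinearMap.range ((cubeBoundary R G (k + 1)).codRestrict
    (LinearMap.ker (cubeBoundary R G k)) fun x => cubeBoundary_cubeBoundary R G x)
  let BH := LinearMap.range ((cubeBoundary R H (l + 1)).codRestrict
    (LinearMap.ker (cubeBoundary R H l)) fun x => cubeBoundary_cubeBoundary R H x)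
  have memG : ∀ z, z ∈ BG ↔ (z : CubeChains R G (k + 1)) ∈
      LinearMap.range (cubeBoundary R G (k + 1)) := fun z =>
    ⟨fun ⟨y, hy⟩ => ⟨y, congrArg Subtype.val hy⟩, fun ⟨y, hy⟩ => ⟨y, Subtype.ext hy⟩⟩
  have memH : ∀ z, z ∈ BH ↔ (z : CubeChains R H (l + 1)) ∈
      LinearMap.range (cubeBoundary R H (l + 1)) := fun z =>
    ⟨fun ⟨y, hy⟩ => ⟨y, congrArg Subtype.val hy⟩, fun ⟨y, hy⟩ => ⟨y, Subtype.ext hy⟩⟩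
  let Ψ : LinearMap.ker (cubeBoundary R G k) →ₗ[R] LinearMap.ker (cubeBoundary R H l) :=
    Φ.restrict hcycle
  have hle : BG ≤ BH.comap Ψ := by
    rintro _ ⟨y, rfl⟩
    exact (memH _).2 (hbdry y)
  refine ⟨(cubeHomologyEquiv R G k).trans
    ((LinearEquiv.ofBijective (Submodule.mapQ BG BH Ψ hle) ⟨?_, ?_⟩).trans
      (cubeHomologyEquiv R H l).symm)⟩
  · rw [← LinearMap.ker_eq_bot, LinearMap.ker_eq_bot']
    intro m
    obtain ⟨z, rfl⟩ := Submodule.Quotient.mk_surjective _ m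
    intro h
    rw [Submodule.mapQ_apply, Submodule.Quotient.mk_eq_zero, memH] at h
    rw [Submodule.Quotient.mk_eq_zero, memG]
    exact hinj _ z.2 h
  · intro m
    obtain ⟨c, rfl⟩ := Submodule.Quotient.mk_surjective _ m
    obtain ⟨z, hz, h⟩ := hsurj c.1 c.2
    refine ⟨Submodule.Quotient.mk ⟨z, hz⟩, ?_⟩
    rw [Submodule.mapQ_apply, Submodule.Quotient.eq, memH]
    exact h

end Homology

/-! ### Chains supported in a set of vertices -/

section Restriction

variable (R : Type v) [CommRing R] {V : Type u} {G : SimpleGraph V} (S T : Set V)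

theorem isGraphMap_val : IsGraphMap (G.induce S) G Subtype.val := fun _ _ h => Or.inr h

variable {S} in
/-- A singular cube with all vertices in `S`, as a cube on the induced subgraph. -/
def SingularCube.codRestrict {d : ℕ} (σ : SingularCube G d) (h : ∀ a, σ.toFun a ∈ S) :
    SingularCube (G.induce S) d where
  toFun a := ⟨σ.toFun a, h a⟩
  isGraphMap a b hab := (σ.isGraphMap a b hab).imp (fun h => Subtype.ext h) id

variable {S} in
theorem SingularCube.IsDegenerate.codRestrict {d : ℕ} {σ : SingularCube G d}
    (hσ : σ.IsDegenerate) (h : ∀ a, σ.toFun a ∈ S) : (σ.codRestrict h).IsDegenerate := by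
  cases d with
  | zero => exact hσ
  | succ d =>
    obtain ⟨i, hi⟩ := hσ
    refine ⟨i, SingularCube.ext (funext fun a => Subtype.ext ?_)⟩
    exact congrFun (congrArg SingularCube.toFun hi) a

/-- The inclusion of the chains of an induced subgraph. -/
noncomputable abbrev chainIncl (d : ℕ) : CubeChains R (G.induce S) d →ₗ[R] CubeChains R G d :=
  cubeMap R (isGraphMap_val S) d

open Classical in
/-- The retraction onto the chains of an induced subgraph, which forgets all cubes that are not
contained in it. It is not a chain map. -/
noncomputable def chainRestrict (d : ℕ) : CubeChains R G d →ₗ[R] CubeChains R (G.induce S) d :=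
  liftChain R (fun σ => if h : ∀ a, σ.toFun a ∈ S then chainOf R (σ.codRestrict h) else 0)
    fun σ hσ => by
      split_ifs with h
      · exact chainOf_eq_zero (hσ.codRestrict h)
      · rfl

variable {S} in
theorem chainRestrict_chainOf {d : ℕ} {σ : SingularCube G d} (h : ∀ a, σ.toFun a ∈ S) :
    chainRestrict R S d (chainOf R σ) = chainOf R (σ.codRestrict h) := by
  simp [chainRestrict, h]

variable {S} in
theorem chainRestrict_chainOf_of_not {d : ℕ} {σ : SingularCube G d} (h : ¬ ∀ a, σ.toFun a ∈ S) :
    chainRestrict R S d (chainOf R σ) = 0 := by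
  rw [chainRestrict, liftChain_chainOf, dif_neg h]

@[simp]
theorem chainRestrict_chainIncl {d : ℕ} (x : CubeChains R (G.induce S) d) :
    chainRestrict R S d (chainIncl R S d x) = x := by
  refine LinearMap.congr_fun (f := chainRestrict R S d ∘ₗ chainIncl R S d) (g := LinearMap.id)
    (CubeChains.hom_ext fun σ => ?_) x
  rw [LinearMap.comp_apply, cubeMap_chainOf,
    chainRestrict_chainOf R (S := S) (fun a => (σ.toFun a).2)]
  rfl

/-- This allows identities between chains on an induced subgraph to be checked in the ambient graph.
-/
theorem chainIncl_injective (d : ℕ) :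
    Function.Injective (chainIncl R S d : CubeChains R (G.induce S) d →ₗ[R] CubeChains R G d) :=
  Function.LeftInverse.injective (chainRestrict_chainIncl R S)

/-- The projection of the chains of a graph to those supported in `S`. -/
noncomputable def chainProj (d : ℕ) : CubeChains R G d →ₗ[R] CubeChains R G d :=
  chainIncl R S d ∘ₗ chainRestrict R S d

theorem chainProj_apply {d : ℕ} (x : CubeChains R G d) :
    chainProj R S d x = chainIncl R S d (chainRestrict R S d x) := rfl

variable {S} in
theorem chainProj_chainOf {d : ℕ} {σ : SingularCube G d} (h : ∀ a, σ.toFun a ∈ S) :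
    chainProj R S d (chainOf R σ) = chainOf R σ := by
  rw [chainProj_apply, chainRestrict_chainOf R h, cubeMap_chainOf]
  rfl

variable {S} in
theorem chainProj_chainOf_of_not {d : ℕ} {σ : SingularCube G d} (h : ¬ ∀ a, σ.toFun a ∈ S) :
    chainProj R S d (chainOf R σ) = 0 := by
  rw [chainProj_apply, chainRestrict_chainOf_of_not R h, map_zero]

@[simp]
theorem chainProj_chainIncl {d : ℕ} (x : CubeChains R (G.induce S) d) :
    chainProj R S d (chainIncl R S d x) = chainIncl R S d x := by
  rw [chainProj_apply, chainRestrict_chainIncl]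

theorem chainProj_chainProj {d : ℕ} (x : CubeChains R G d) :
    chainProj R S d (chainProj R T d x) = chainProj R (S ∩ T) d x := by
  refine LinearMap.congr_fun (f := chainProj R S d ∘ₗ chainProj R T d)
    (CubeChains.hom_ext fun σ => ?_) x
  rw [LinearMap.comp_apply]
  by_cases hT : ∀ a, σ.toFun a ∈ T
  · rw [chainProj_chainOf R hT]
    by_cases hS : ∀ a, σ.toFun a ∈ S
    · rw [chainProj_chainOf R hS, chainProj_chainOf R (S := S ∩ T) (fun a => ⟨hS a, hT a⟩)]
    · rw [chainProj_chainOf_of_not R hS, chainProj_chainOf_of_not R (S := S ∩ T) (fun h => hS fun a => (h a).1)]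
  · rw [chainProj_chainOf_of_not R hT, map_zero,
      chainProj_chainOf_of_not R (S := S ∩ T) (fun h => hT fun a => (h a).2)]

variable {S T} in
/-- If all `d`-cubes lie in `S` or in `T`, then the part of a chain outside `S` lies in `T`. -/
theorem chainProj_sub_chainProj {d : ℕ}
    (hST : ∀ σ : SingularCube G d, (∀ a, σ.toFun a ∈ S) ∨ ∀ a, σ.toFun a ∈ T)
    (x : CubeChains R G d) :
    chainProj R T d (x - chainProj R S d x) = x - chainProj R S d x := by
  refine LinearMap.congr_fun (f := chainProj R T d ∘ₗ (LinearMap.id - chainProj R S d))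
    (g := LinearMap.id - chainProj R S d) (CubeChains.hom_ext fun σ => ?_) x
  simp only [LinearMap.comp_apply, LinearMap.sub_apply, LinearMap.id_apply]
  rcases hST σ with h | h
  · rw [chainProj_chainOf R h, sub_self, map_zero]
  · by_cases hS : ∀ a, σ.toFun a ∈ S
    · rw [chainProj_chainOf R hS, sub_self, map_zero]
    · rw [chainProj_chainOf_of_not R hS, sub_zero, chainProj_chainOf R h]

end Restriction

/-! ### The Mayer-Vietoris isomorphism -/

section MayerVietoris

variable (R : Type v) [CommRing R] {V : Type u} {G : SimpleGraph V} {S T : Set V}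

/-- The cubical homology of the graph vanishes in all positive degrees. -/
def IsCubeAcyclic {W : Type u} (H : SimpleGraph W) : Prop :=
  ∀ (d : ℕ) (z : CubeChains R H (d + 1)), cubeBoundary R H d z = 0 →
    z ∈ LinearMap.range (cubeBoundary R H (d + 1))

/-- Faces of a cube in `S` lie in `S`. The support hypothesis matters: a cube outside `S` may have
faces in `S`, so the projection is not a chain map. -/
theorem cubeBoundary_chainProj {d : ℕ} {x : CubeChains R G (d + 1)}
    (hx : chainProj R S (d + 1) x = x) :
    chainProj R S d (cubeBoundary R G d x) = cubeBoundary R G d x := by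
  rw [← hx, chainProj_apply R S (d := d + 1), cubeBoundary_cubeMap, chainProj_chainIncl]

variable {R} in
theorem IsCubeAcyclic.exists_of_chainProj (hS : IsCubeAcyclic R (G.induce S)) {d : ℕ}
    {x : CubeChains R G (d + 1)} (hx : chainProj R S (d + 1) x = x)
    (hd : cubeBoundary R G d x = 0) :
    ∃ y, chainProj R S (d + 2) y = y ∧ cubeBoundary R G (d + 1) y = x := by
  obtain ⟨y, hy⟩ := hS d (chainRestrict R S (d + 1) x) <| chainIncl_injective R S d <| by
    rw [← cubeBoundary_cubeMap, ← chainProj_apply, hx, hd, map_zero]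
  refine ⟨chainIncl R S (d + 2) y, chainProj_chainIncl R S y, ?_⟩
  rw [cubeBoundary_cubeMap, hy, ← chainProj_apply, hx]

variable (S T) in
/-- The connecting map of the Mayer-Vietoris sequence on chains. -/
noncomputable def chainConnecting (d : ℕ) :
    CubeChains R G (d + 1) →ₗ[R] CubeChains R (G.induce (S ∩ T)) d :=
  chainRestrict R (S ∩ T) d ∘ₗ cubeBoundary R G d ∘ₗ chainProj R S (d + 1)

/-- Write `z = z_S + z_T`. From `∂z = 0` follows `∂z_S = -∂z_T`, a chain supported in both `S` and
`T`, so restricting to `S ∩ T` loses nothing. -/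
theorem chainIncl_chainConnecting {d : ℕ}
    (hST : ∀ σ : SingularCube G (d + 1), (∀ a, σ.toFun a ∈ S) ∨ ∀ a, σ.toFun a ∈ T)
    {z : CubeChains R G (d + 1)} (hz : cubeBoundary R G d z = 0) :
    chainIncl R (S ∩ T) d (chainConnecting R S T d z) =
      cubeBoundary R G d (chainProj R S (d + 1) z) := by
  change chainProj R (S ∩ T) d (cubeBoundary R G d (chainProj R S (d + 1) z)) = _
  have hS : chainProj R S (d + 1) (chainProj R S (d + 1) z) = chainProj R S (d + 1) z := by
    rw [chainProj_chainProj, Set.inter_self]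
  have hT := cubeBoundary_chainProj R (chainProj_sub_chainProj R hST z)
  rw [map_sub, hz, zero_sub, map_neg, neg_inj] at hT
  rw [← chainProj_chainProj, hT, cubeBoundary_chainProj R hS]

/-- Covering all cubes by `S` and `T` is needed only in dimensions `d + 2` and `d + 3`, those of the
cycles and of the chains they bound. Both homology degrees are positive, so reduced homology is not
needed. -/
theorem nonempty_cubeHomology_equiv_inter {d : ℕ}
    (hST : ∀ k ≤ d + 3, ∀ σ : SingularCube G k, (∀ a, σ.toFun a ∈ S) ∨ ∀ a, σ.toFun a ∈ T)
    (hS : IsCubeAcyclic R (G.induce S)) (hT : IsCubeAcyclic R (G.induce T)) :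
    Nonempty (cubeHomology R G (d + 2) ≃ₗ[R] cubeHomology R (G.induce (S ∩ T)) (d + 1)) := by
  have hST2 := hST (d + 2) (by omega)
  have hproj : ∀ {A : Set V} {k : ℕ} (x : CubeChains R G k),
      chainProj R A k (chainProj R A k x) = chainProj R A k x := fun x => by
    rw [chainProj_chainProj, Set.inter_self]
  refine nonempty_cubeHomology_equiv R (chainConnecting R S T (d + 1)) ?_ ?_ ?_ ?_
  · intro z hz
    refine chainIncl_injective R (S ∩ T) d ?_
    rw [← cubeBoundary_cubeMap, chainIncl_chainConnecting R hST2 hz, cubeBoundary_cubeBoundary,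
      map_zero]
  · intro y
    set yT := y - chainProj R S (d + 3) y with hyT
    have hT' : chainProj R T (d + 2) (cubeBoundary R G (d + 2) yT) = cubeBoundary R G (d + 2) yT :=
      cubeBoundary_chainProj R (chainProj_sub_chainProj R (hST _ le_rfl) y)
    have hS' := cubeBoundary_chainProj R (hproj (A := S) y)
    -- The `S`-part of `∂y` is `∂y_S` plus the `S`-part of `∂y_T`. The first term is a cycle; the
    -- second lies in `S ∩ T` and is the witness.
    refine ⟨chainRestrict R (S ∩ T) (d + 2) (cubeBoundary R G (d + 2) yT),
      chainIncl_injective R (S ∩ T) (d + 1) ?_⟩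
    rw [← cubeBoundary_cubeMap, ← chainProj_apply, ← chainProj_chainProj, hT',
      chainIncl_chainConnecting R hST2 (cubeBoundary_cubeBoundary R G y)]
    have hy : y = yT + chainProj R S (d + 3) y := by simp [hyT]
    conv_rhs => rw [hy, map_add, map_add, hS', map_add, cubeBoundary_cubeBoundary, add_zero]
  · rintro z hz ⟨w, hw⟩
    have hd := chainIncl_chainConnecting R hST2 hz
    rw [← hw, ← cubeBoundary_cubeMap] at hd
    set w' := chainIncl R (S ∩ T) (d + 2) w
    have hw' : chainProj R (S ∩ T) (d + 2) w' = w' := chainProj_chainIncl R (S ∩ T) w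
    have hwS : chainProj R S (d + 2) w' = w' := by
      rw [← hw', chainProj_chainProj, ← Set.inter_assoc, Set.inter_self]
    have hwT : chainProj R T (d + 2) w' = w' := by
      rw [← hw', chainProj_chainProj, Set.inter_left_comm, Set.inter_self]
    -- Since `∂z_S = ∂w'`, the chain `z` is the sum of the cycles `z_S - w'` in `S` and `z_T + w'`
    -- in `T`, and each of them bounds.
    obtain ⟨a, -, ha⟩ := hS.exists_of_chainProj (x := chainProj R S (d + 2) z - w')
      (by rw [map_sub, hproj, hwS]) (by rw [map_sub, hd, sub_self])
    obtain ⟨b, -, hb⟩ := hT.exists_of_chainProj (x := z - chainProj R S (d + 2) z + w')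
      (by rw [map_add, chainProj_sub_chainProj R hST2, hwT])
      (by rw [map_add, map_sub, hd, hz, zero_sub, neg_add_cancel])
    exact ⟨a + b, by rw [map_add, ha, hb]; abel⟩
  · intro c hc
    have hc' : cubeBoundary R G d (chainIncl R (S ∩ T) (d + 1) c) = 0 := by
      rw [cubeBoundary_cubeMap, hc, map_zero]
    have hcc := chainProj_chainIncl R (S ∩ T) c
    obtain ⟨a, haS, ha⟩ := hS.exists_of_chainProj (x := chainIncl R (S ∩ T) (d + 1) c)
      (by rw [← hcc, chainProj_chainProj, ← Set.inter_assoc, Set.inter_self]) hc'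
    obtain ⟨b, hbT, hb⟩ := hT.exists_of_chainProj (x := chainIncl R (S ∩ T) (d + 1) c)
      (by rw [← hcc, chainProj_chainProj, Set.inter_left_comm, Set.inter_self]) hc'
    have hz : cubeBoundary R G (d + 1) (a - b) = 0 := by rw [map_sub, ha, hb, sub_self]
    -- The `S`-part of `a - b` is `a` minus the part of `b` in `S ∩ T`, so its boundary misses `c`
    -- by the boundary of that part.
    refine ⟨a - b, hz, -chainRestrict R (S ∩ T) (d + 2) b,
      chainIncl_injective R (S ∩ T) (d + 1) ?_⟩
    rw [← cubeBoundary_cubeMap, map_neg, ← chainProj_apply, map_sub,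
      chainIncl_chainConnecting R hST2 hz, map_sub, haS, map_sub, ha, map_neg,
      ← chainProj_chainProj, hbT]
    abel

end MayerVietoris

/-! ### Contractions and deformation retracts -/

section Deformation

variable (R : Type v) [CommRing R] {V W : Type u} {G : SimpleGraph V} {H : SimpleGraph W}

theorem IsCubeAcyclic.of_contraction {F : ℕ → V → V} (hF : ∀ t, IsGraphMap G G (F t))
    (hc : ∀ t, CloseMaps G (F t) (F (t + 1))) (h0 : ∀ x, F 0 x = x) (n : ℕ)
    (hn : ∀ x y, F n x = F n y) : IsCubeAcyclic R G := by
  intro d z hz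
  have h := cubeMap_sub_cubeMap_mem R hF hc hz n
  rwa [cubeMap_const R (hF n) hn, cubeMap_id R (hF 0) h0, zero_sub, neg_mem_iff] at h

theorem nonempty_cubeHomology_equiv_of_deformation {π : V → W} {ι : W → V}
    (hπ : IsGraphMap G H π) (hι : IsGraphMap H G ι) (hπι : ∀ y, π (ι y) = y)
    {F : ℕ → V → V} (hF : ∀ t, IsGraphMap G G (F t)) (hc : ∀ t, CloseMaps G (F t) (F (t + 1)))
    (h0 : ∀ x, F 0 x = x) (n : ℕ) (hn : ∀ x, F n x = ι (π x)) (d : ℕ) :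
    Nonempty (cubeHomology R G (d + 1) ≃ₗ[R] cubeHomology R H (d + 1)) := by
  refine nonempty_cubeHomology_equiv R (cubeMap R hπ (d + 1)) ?_ ?_ ?_ ?_
  · intro z hz
    rw [cubeBoundary_cubeMap, hz, map_zero]
  · intro y
    exact ⟨cubeMap R hπ (d + 2) y, cubeBoundary_cubeMap R hπ y⟩
  · rintro z hz ⟨w, hw⟩
    have h := cubeMap_sub_cubeMap_mem R hF hc hz n
    rw [← cubeMap_cubeMap R hπ hι (hF n) (fun x => (hn x).symm), ← hw, ← cubeBoundary_cubeMap,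
      cubeMap_id R (hF 0) h0, sub_mem_comm_iff] at h
    simpa using Submodule.add_mem _ h (LinearMap.mem_range_self _ (cubeMap R hι (d + 2) w))
  · intro c hcyc
    refine ⟨cubeMap R hι (d + 1) c, by rw [cubeBoundary_cubeMap, hcyc, map_zero], ?_⟩
    have hid : IsGraphMap H H id := fun _ _ h => Or.inr h
    rw [cubeMap_cubeMap R hι hπ hid hπι, cubeMap_id R hid fun _ => rfl, sub_self]
    exact Submodule.zero_mem _

end Deformation

/-! ### The diameter of the cube -/

section CubeDiameter

/-- A function on the cube that changes by at most `1` along edges changes by at most the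
dimension. -/
theorem discreteCube_lipschitz : ∀ {d : ℕ} (φ : (Fin d → Bool) → ℕ),
    (∀ a b, (discreteCube d).Adj a b → φ a ≤ φ b + 1) → ∀ a b, φ a ≤ φ b + d
  | 0, φ, _, a, b => by rw [Subsingleton.elim a b]; omega
  | d + 1, φ, hφ, a, b => by
    have h1 := discreteCube_lipschitz (fun c => φ ((0 : Fin (d + 1)).insertNth (a 0) c))
      (fun _ _ h => hφ _ _ (SingularCube.adj_insertNth 0 (a 0) h)) (Fin.tail a) (Fin.tail b)
    have ha : ((0 : Fin (d + 1)).insertNth (a 0) (Fin.tail a) : Fin (d + 1) → Bool) = a := by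
      simp
    have hb : ((0 : Fin (d + 1)).insertNth (b 0) (Fin.tail b) : Fin (d + 1) → Bool) = b := by
      simp
    -- `b` is first moved into the slice of `a`, at the cost of at most one edge; induction handles
    -- the slice.
    have h2 : φ ((0 : Fin (d + 1)).insertNth (a 0) (Fin.tail b)) ≤ φ b + 1 := by
      by_cases h : a 0 = b 0
      · rw [h, hb]
        omega
      · refine hφ _ _ ⟨0, by simpa using h, fun k hk => ?_⟩
        by_contra hk0
        obtain ⟨j, rfl⟩ := Fin.exists_succ_eq.2 hk0
        simp [Fin.tail] at hk
    simp only [ha] at h1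
    omega

end CubeDiameter

/-! ### Suspensions and their levels -/

section Levels

variable {V : Type u} {G : SimpleGraph V} {N : ℕ}

variable (N) in
/-- The vertex of the suspension given by `(g, k)`, where `k` is cut off at `N`. -/
def suspPt (g : V) (k : ℕ) : Quotient (endsSetoid V N) :=
  Quotient.mk _ (g, ⟨min k N, by omega⟩)

/-- The second coordinate of a vertex of the suspension. -/
def suspHeight : Quotient (endsSetoid V N) → ℕ :=
  Quotient.lift (fun p => (p.2 : ℕ)) <| by
    rintro p q (rfl | ⟨h1, h2⟩ | ⟨h1, h2⟩)
    · rfl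
    · simp [h1, h2]
    · simp [h1, h2]

/-- The first coordinate of a vertex of the suspension, chosen arbitrarily at the two poles. -/
noncomputable def suspBase (x : Quotient (endsSetoid V N)) : V := x.out.1

@[simp]
theorem suspHeight_suspPt (g : V) (k : ℕ) : suspHeight (suspPt N g k) = min k N := rfl

theorem suspHeight_le (x : Quotient (endsSetoid V N)) : suspHeight x ≤ N := by
  induction x using Quotient.ind with
  | _ p => exact Nat.le_of_lt_succ p.2.2

theorem mk_eq_suspPt (p : V × Fin (N + 1)) :
    Quotient.mk (endsSetoid V N) p = suspPt N p.1 p.2 := by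
  have : min (p.2 : ℕ) N = p.2 := min_eq_left (Nat.le_of_lt_succ p.2.2)
  simp [suspPt, this]

theorem suspPt_base_height (x : Quotient (endsSetoid V N)) :
    suspPt N (suspBase x) (suspHeight x) = x := by
  have h := mk_eq_suspPt x.out
  have h2 : suspHeight x = x.out.2 := by
    conv_lhs => rw [← Quotient.out_eq x]
    rfl
  rw [Quotient.out_eq] at h
  rw [h2]
  exact h.symm

theorem suspPt_eq_of_pole (g g' : V) {k : ℕ} (hk : k = 0 ∨ N ≤ k) :
    suspPt N g k = suspPt N g' k := by
  refine Quotient.sound (Or.inr (hk.imp ?_ ?_))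
  · rintro rfl
    simp
  · intro h
    simp [Fin.ext_iff, h]

/-- Strictly between the poles the classes are singletons, so the arbitrary choice of representative
is forced. -/
theorem suspBase_suspPt (g : V) {k : ℕ} (h0 : 0 < k) (hN : k < N) :
    suspBase (suspPt N g k) = g := by
  have h := Quotient.exact (suspPt_base_height (suspPt N g k))
  rcases h with h | ⟨-, h⟩ | ⟨-, h⟩
  · exact congrArg Prod.fst h
  · simp only [Fin.ext_iff, Fin.val_zero] at h
    omega
  · simp only [Fin.ext_iff, Fin.val_last] at h
    omega

theorem suspPt_close_base {g g' : V} (h : G.Adj g g') (k : ℕ) :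
    suspPt N g k = suspPt N g' k ∨ (suspensionGraph G N).Adj (suspPt N g k) (suspPt N g' k) := by
  by_cases he : suspPt N g k = suspPt N g' k
  · exact Or.inl he
  · exact Or.inr ⟨he, (g, _), (g', _), Or.inl ⟨h, rfl⟩, rfl, rfl⟩

theorem suspPt_close_height (g : V) {k l : ℕ} (h1 : k ≤ l + 1) (h2 : l ≤ k + 1) :
    suspPt N g k = suspPt N g l ∨ (suspensionGraph G N).Adj (suspPt N g k) (suspPt N g l) := by
  by_cases he : suspPt N g k = suspPt N g l
  · exact Or.inl he
  · refine Or.inr ⟨he, (g, ⟨min k N, by omega⟩), (g, ⟨min l N, by omega⟩), Or.inr ⟨?_, rfl⟩, rfl, rfl⟩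
    have : min k N ≠ min l N := fun h => he (by simp only [suspPt, h])
    rw [SimpleGraph.pathGraph_adj]
    simp only
    omega

theorem suspensionGraph_adj {x y : Quotient (endsSetoid V N)} (h : (suspensionGraph G N).Adj x y) :
    ∃ g g' k l, k ≤ N ∧ l ≤ N ∧ x = suspPt N g k ∧ y = suspPt N g' l ∧
      (G.Adj g g' ∧ k = l ∨ g = g' ∧ (k + 1 = l ∨ l + 1 = k)) := by
  obtain ⟨-, p, q, hpq, rfl, rfl⟩ := h
  refine ⟨p.1, q.1, p.2, q.2, Nat.le_of_lt_succ p.2.2, Nat.le_of_lt_succ q.2.2, mk_eq_suspPt p,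
    mk_eq_suspPt q, ?_⟩
  rcases hpq with ⟨h, h'⟩ | ⟨h, h'⟩
  · exact Or.inl ⟨h, congrArg Fin.val h'⟩
  · exact Or.inr ⟨h', SimpleGraph.pathGraph_adj.1 h⟩

theorem suspHeight_le_of_adj {x y : Quotient (endsSetoid V N)}
    (h : (suspensionGraph G N).Adj x y) : suspHeight x ≤ suspHeight y + 1 := by
  obtain ⟨g, g', k, l, hk, hl, rfl, rfl, ⟨-, h⟩ | ⟨-, h⟩⟩ := suspensionGraph_adj h <;>
    simp only [suspHeight_suspPt] <;> omega

theorem SingularCube.height_le {d : ℕ} (σ : SingularCube (suspensionGraph G N) d)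
    (a b : Fin d → Bool) : suspHeight (σ.toFun a) ≤ suspHeight (σ.toFun b) + d := by
  refine discreteCube_lipschitz (fun a => suspHeight (σ.toFun a)) (fun a b h => ?_) a b
  rcases σ.isGraphMap a b h with h | h
  · simp only [h]
    omega
  · exact suspHeight_le_of_adj h

/-- The map of the suspension that applies `m` to the heights. -/
noncomputable def levelMap (m : ℕ → ℕ) (x : Quotient (endsSetoid V N)) :
    Quotient (endsSetoid V N) :=
  suspPt N (suspBase x) (m (suspHeight x))

/-- At a pole the base is arbitrary, so the result is independent of it only if poles go to poles.
-/
theorem levelMap_suspPt {m : ℕ → ℕ} (g : V) {k : ℕ} (hk : k ≤ N)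
    (hm : k = 0 ∨ k = N → m k = 0 ∨ N ≤ m k) : levelMap m (suspPt N g k) = suspPt N g (m k) := by
  rw [levelMap, suspHeight_suspPt, min_eq_left hk]
  by_cases h : k = 0 ∨ k = N
  · exact suspPt_eq_of_pole _ _ (hm h)
  · rw [suspBase_suspPt g (by omega) (by omega)]

variable (V N) in
/-- The vertices of the suspension with height in a given set. -/
def suspLevels (P : Set ℕ) : Set (Quotient (endsSetoid V N)) := {x | suspHeight x ∈ P}

/-- Conditions on a map of heights to induce a graph map on the part of the suspension with
heights in `P`. -/
structure IsLevelMap (N : ℕ) (P : Set ℕ) (m : ℕ → ℕ) : Prop where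
  mem : ∀ k ≤ N, k ∈ P → min (m k) N ∈ P
  pole : ∀ k ∈ P, k = 0 ∨ k = N → m k = 0 ∨ N ≤ m k
  le_succ : ∀ k, m k ≤ m (k + 1) + 1
  succ_le : ∀ k, m (k + 1) ≤ m k + 1

variable {P : Set ℕ}

/-- The restriction of a level map to the part of the suspension with heights in `P`. -/
noncomputable def IsLevelMap.restrict {m : ℕ → ℕ} (hm : IsLevelMap N P m) (x : suspLevels V N P) :
    suspLevels V N P :=
  ⟨levelMap m x, hm.mem _ (suspHeight_le _) x.2⟩

theorem IsLevelMap.isGraphMap {m : ℕ → ℕ} (hm : IsLevelMap N P m) :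
    IsGraphMap ((suspensionGraph G N).induce (suspLevels V N P))
      ((suspensionGraph G N).induce (suspLevels V N P)) hm.restrict := by
  rintro ⟨x, hx⟩ ⟨y, hy⟩ h
  obtain ⟨g, g', k, l, hk, hl, rfl, rfl, hkl⟩ := suspensionGraph_adj h
  have hk' : k ∈ P := by simpa [suspLevels, hk] using hx
  have hl' : l ∈ P := by simpa [suspLevels, hl] using hy
  refine Or.imp_left Subtype.ext (?_ : levelMap m (suspPt N g k) = levelMap m (suspPt N g' l) ∨
    (suspensionGraph G N).Adj (levelMap m (suspPt N g k)) (levelMap m (suspPt N g' l)))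
  rw [levelMap_suspPt g hk (hm.pole k hk'), levelMap_suspPt g' hl (hm.pole l hl')]
  rcases hkl with ⟨hg, rfl⟩ | ⟨rfl, rfl | rfl⟩
  · exact suspPt_close_base hg _
  · exact suspPt_close_height g (hm.le_succ k) (hm.succ_le k)
  · exact suspPt_close_height g (hm.succ_le l) (hm.le_succ l)

theorem IsLevelMap.closeMaps {m m' : ℕ → ℕ} (hm : IsLevelMap N P m) (hm' : IsLevelMap N P m')
    (h1 : ∀ k, m k ≤ m' k + 1) (h2 : ∀ k, m' k ≤ m k + 1) :
    CloseMaps ((suspensionGraph G N).induce (suspLevels V N P)) hm.restrict hm'.restrict := by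
  intro x
  exact Or.imp_left Subtype.ext (suspPt_close_height (suspBase x.1) (h1 _) (h2 _))

theorem IsLevelMap.restrict_eq_self {m : ℕ → ℕ} (hm : IsLevelMap N P m) (h : ∀ k ≤ N, m k = k)
    (x : suspLevels V N P) : hm.restrict x = x := by
  refine Subtype.ext ?_
  change suspPt N (suspBase x.1) (m (suspHeight x.1)) = x.1
  rw [h _ (suspHeight_le _), suspPt_base_height]

/-- The heights `max k t` sweep everything to the top pole. The bottom pole must be absent, because
it would be lifted to a level where the base matters. -/
theorem isCubeAcyclic_upper (R : Type v) [CommRing R] (G : SimpleGraph V) (N : ℕ) :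
    IsCubeAcyclic R ((suspensionGraph G N).induce (suspLevels V N {k | 0 < k})) := by
  have hm : ∀ t, IsLevelMap N {k | 0 < k} (fun k => max k t) := fun t =>
    ⟨by grind, by grind, by grind, by grind⟩
  refine IsCubeAcyclic.of_contraction R (F := fun t => (hm t).restrict)
    (fun t => (hm t).isGraphMap) (fun t => (hm t).closeMaps (hm _) (by grind) (by grind))
    ((hm 0).restrict_eq_self (by grind)) N fun x y => Subtype.ext ?_
  have h : ∀ z : Quotient (endsSetoid V N), max (suspHeight z) N = N := fun z =>
    max_eq_right (suspHeight_le z)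
  simp only [IsLevelMap.restrict, levelMap, h]
  exact suspPt_eq_of_pole _ _ (Or.inr le_rfl)

theorem isCubeAcyclic_lower (R : Type v) [CommRing R] (G : SimpleGraph V) (N : ℕ) :
    IsCubeAcyclic R ((suspensionGraph G N).induce (suspLevels V N {k | k < N})) := by
  have hm : ∀ t, IsLevelMap N {k | k < N} (fun k => min k (N - t)) := fun t =>
    ⟨by grind, by grind, by grind, by grind⟩
  refine IsCubeAcyclic.of_contraction R (F := fun t => (hm t).restrict)
    (fun t => (hm t).isGraphMap) (fun t => (hm t).closeMaps (hm _) (by grind) (by grind))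
    ((hm 0).restrict_eq_self (by grind)) N fun x y => Subtype.ext ?_
  simp only [IsLevelMap.restrict, levelMap, Nat.sub_self, Nat.min_zero]
  exact suspPt_eq_of_pole _ _ (Or.inl rfl)

theorem nonempty_cubeHomology_equiv_middle (R : Type v) [CommRing R] (G : SimpleGraph V)
    (hN : 2 ≤ N) (d : ℕ) :
    Nonempty (cubeHomology R ((suspensionGraph G N).induce (suspLevels V N {k | 0 < k ∧ k < N}))
      (d + 1) ≃ₗ[R] cubeHomology R G (d + 1)) := by
  -- Heights are lowered step by step; the `max` with 1 stops the sweep just above the bottom pole.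
  have hm : ∀ t, IsLevelMap N {k | 0 < k ∧ k < N} (fun k => min k (max (N - t) 1)) := fun t =>
    ⟨by grind, by grind, by grind, by grind⟩
  refine nonempty_cubeHomology_equiv_of_deformation R
    (π := fun x : suspLevels V N {k | 0 < k ∧ k < N} => suspBase x.1)
    (ι := fun g => ⟨suspPt N g 1, by simp [suspLevels]; omega⟩) ?_ ?_ ?_
    (F := fun t => (hm t).restrict)
    (fun t => (hm t).isGraphMap) (fun t => (hm t).closeMaps (hm _) (by grind) (by grind))
    ((hm 0).restrict_eq_self (by grind)) N ?_ d
  · rintro ⟨x, hx⟩ ⟨y, hy⟩ h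
    obtain ⟨g, g', k, l, hk, hl, rfl, rfl, hkl⟩ := suspensionGraph_adj h
    simp only [suspLevels, Set.mem_ofPred_eq, suspHeight_suspPt] at hx hy
    simp only
    rw [suspBase_suspPt g (by omega) (by omega), suspBase_suspPt g' (by omega) (by omega)]
    exact hkl.symm.imp And.left And.left
  · intro g g' h
    exact Or.imp_left Subtype.ext (suspPt_close_base h 1)
  · intro g
    exact suspBase_suspPt g one_pos hN
  · rintro ⟨x, hx⟩
    refine Subtype.ext ?_
    have : min (suspHeight x) (max (N - N) 1) = 1 := by
      have : 0 < suspHeight x := hx.1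
      omega
    simp only [IsLevelMap.restrict, levelMap, this]

theorem nonempty_cubeHomology_suspension_equiv (R : Type v) [CommRing R] (G : SimpleGraph V)
    (d : ℕ) (hN : d + 4 ≤ N) :
    Nonempty (cubeHomology R (suspensionGraph G N) (d + 2) ≃ₗ[R] cubeHomology R G (d + 1)) := by
  obtain ⟨e'⟩ := nonempty_cubeHomology_equiv_middle R G (by omega : 2 ≤ N) d
  have h : ∀ k ≤ d + 3, ∀ σ : SingularCube (suspensionGraph G N) k,
      (∀ a, σ.toFun a ∈ suspLevels V N {k | 0 < k}) ∨
        ∀ a, σ.toFun a ∈ suspLevels V N {k | k < N} := by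
    intro k hk σ
    by_contra! h
    obtain ⟨⟨a, ha⟩, b, hb⟩ := h
    -- Here `a` has height 0 and `b` height `N`, although a cube of dimension at most `d + 3` cannot
    -- span `d + 4` levels.
    have := σ.height_le b a
    simp only [suspLevels, Set.mem_ofPred_eq] at ha hb
    omega
  obtain ⟨e⟩ := nonempty_cubeHomology_equiv_inter R h
    (isCubeAcyclic_upper R G N) (isCubeAcyclic_lower R G N)
  exact ⟨e.trans e'⟩

end Levels

/-! ### Detecting nonzero classes -/

section LowDimensions

variable (R : Type v) [CommRing R] {V : Type u} {G : SimpleGraph V}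

/-- The singular `0`-cube at a vertex. -/
def pointCube (G : SimpleGraph V) (v : V) : SingularCube G 0 where
  toFun _ := v
  isGraphMap _ _ _ := Or.inl rfl

/-- The singular `1`-cube along an edge. -/
def edgeCube {v w : V} (h : G.Adj v w) : SingularCube G 1 where
  toFun a := if a 0 then w else v
  isGraphMap a b _ := by
    have := h.symm
    cases ha : a 0 <;> cases hb : b 0 <;> simp [*]

theorem cubeBoundary_edgeCube {v w : V} (h : G.Adj v w) :
    cubeBoundary R G 0 (chainOf R (edgeCube h)) =
      chainOf R (pointCube G w) - chainOf R (pointCube G v) := by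
  have h0 : (edgeCube h).face 0 false = pointCube G v := by
    ext a
    simp [SingularCube.face, edgeCube, pointCube]
  have h1 : (edgeCube h).face 0 true = pointCube G w := by
    ext a
    simp [SingularCube.face, edgeCube, pointCube]
  simp [cubeBoundary_chainOf, h0, h1]

/-- The augmentation `ε` kills boundaries and takes the value 1 on a point. -/
theorem nontrivial_cubeHomology_zero [Nontrivial R] [Nonempty V] (G : SimpleGraph V) :
    Nontrivial (cubeHomology R G 0) := by
  let S : ShortComplex (ModuleCat.{max u v} R) := ShortComplex.mk
    (ModuleCat.ofHom (cubeBoundary R G 0)) (0 : _ ⟶ ModuleCat.of R (CubeChains R G 0)) (by simp)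
  let e : (cubeComplex R G).sc' 1 0 0 ≅ S :=
    ShortComplex.isoMk (Iso.refl _) (Iso.refl _) (Iso.refl _)
      (by simp [S, cubeComplex_d]; rfl) (by simp [S]; exact Limits.comp_zero.trans Limits.zero_comp.symm)
  let E := (((cubeComplex R G).homologyIsoSc' 1 0 0 (by simp) (by simp)) ≪≫
    ShortComplex.homologyMapIso e ≪≫ S.moduleCatHomologyIso).toLinearEquiv
  let ε : CubeChains R G 0 →ₗ[R] R := liftChain R (fun _ => 1) fun _ h => h.elim
  have hε : ∀ y, ε (cubeBoundary R G 0 y) = 0 := fun y =>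
    LinearMap.congr_fun (f := ε ∘ₗ cubeBoundary R G 0) (g := 0)
      (CubeChains.hom_ext fun σ => by simp [cubeBoundary_chainOf, ε]) y
  let p : LinearMap.ker S.g.hom :=
    ⟨chainOf R (pointCube G (Classical.arbitrary V)), by simp [S]⟩
  have hp : p ∉ LinearMap.range S.moduleCatToCycles := by
    rintro ⟨y, hy⟩
    have h := hε y
    rw [show cubeBoundary R G 0 y = p.1 from congrArg Subtype.val hy] at h
    simp [p, ε] at h
  have : Nontrivial S.moduleCatLeftHomologyData.H :=
    ⟨Submodule.Quotient.mk p, 0, fun h => hp ((Submodule.Quotient.mk_eq_zero _).1 h)⟩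
  exact E.toEquiv.nontrivial

theorem nontrivial_cubeHomology_succ {d : ℕ} {z : CubeChains R G (d + 1)}
    (hz : cubeBoundary R G d z = 0) (hz' : z ∉ LinearMap.range (cubeBoundary R G (d + 1))) :
    Nontrivial (cubeHomology R G (d + 1)) := by
  have := (cubeHomologyEquiv R G d).toEquiv.nontrivial_congr
  refine this.2 ⟨Submodule.Quotient.mk ⟨z, hz⟩, 0, fun h => hz' ?_⟩
  obtain ⟨y, hy⟩ := (Submodule.Quotient.mk_eq_zero _).1 h
  exact ⟨y, congrArg Subtype.val hy⟩

end LowDimensions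

/-! ### The pentagon in degree 1 -/

section Pentagon

variable (R : Type v) [CommRing R]

/-- The signed number of times a step in the pentagon crosses the edge from `4` to `0`. -/
def pentagonCrossing (a b : Fin 5) : ℤ :=
  if a = 4 ∧ b = 0 then 1 else if a = 0 ∧ b = 4 then -1 else 0

/-- Closed walks of length at most 4 in the pentagon have winding number 0. This would fail for the
3- and 4-cycles. -/
theorem pentagonCrossing_square : ∀ a b c d : Fin 5,
    (a = b ∨ a - b = 1 ∨ b - a = 1) → (a = c ∨ a - c = 1 ∨ c - a = 1) →
    (b = d ∨ b - d = 1 ∨ d - b = 1) → (c = d ∨ c - d = 1 ∨ d - c = 1) →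
    pentagonCrossing a b + pentagonCrossing b d = pentagonCrossing a c + pentagonCrossing c d := by
  decide

/-- The crossing number as a cochain on the pentagon. -/
noncomputable def pentagonCochain : CubeChains R (SimpleGraph.cycleGraph 5) 1 →ₗ[R] R :=
  liftChain R (fun σ => (pentagonCrossing (σ.toFun fun _ => false) (σ.toFun fun _ => true) : R)) <| by
    rintro σ ⟨i, hi⟩
    obtain rfl := Fin.fin_one_eq_zero i
    have h : σ.toFun (fun _ => true) = σ.toFun (fun _ => false) := by
      have := congrFun (congrArg SingularCube.toFun hi) Fin.elim0
      have h1 : ∀ e, ((0 : Fin 1).insertNth e (Fin.elim0 : Fin 0 → Bool) : Fin 1 → Bool) =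
          fun _ => e := fun e => by
        funext k
        obtain rfl := Fin.fin_one_eq_zero k
        simp
      simpa only [SingularCube.face, h1] using this
    rw [h]
    generalize σ.toFun (fun _ => false) = a
    fin_cases a <;> simp [pentagonCrossing]

theorem pentagonCochain_chainOf (σ : SingularCube (SimpleGraph.cycleGraph 5) 1) :
    pentagonCochain R (chainOf R σ) =
      pentagonCrossing (σ.toFun fun _ => false) (σ.toFun fun _ => true) := by
  rw [pentagonCochain, liftChain_chainOf]

theorem pentagonCochain_cubeBoundary (y : CubeChains R (SimpleGraph.cycleGraph 5) 2) :
    pentagonCochain R (cubeBoundary R (SimpleGraph.cycleGraph 5) 1 y) = 0 := by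
  refine LinearMap.congr_fun (f := pentagonCochain R ∘ₗ cubeBoundary R _ 1) (g := 0)
    (CubeChains.hom_ext fun σ => ?_) y
  have hf : ∀ e f : Bool, ((0 : Fin 2).insertNth e (fun _ : Fin 1 => f) : Fin 2 → Bool) = ![e, f] :=
    by decide
  have hf' : ∀ e f : Bool, ((1 : Fin 2).insertNth e (fun _ : Fin 1 => f) : Fin 2 → Bool) = ![f, e] :=
    by decide
  have hadj : ∀ a b, (discreteCube 2).Adj a b → σ.toFun a = σ.toFun b ∨
      σ.toFun a - σ.toFun b = 1 ∨ σ.toFun b - σ.toFun a = 1 := σ.isGraphMap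
  have h := pentagonCrossing_square (σ.toFun ![false, false]) (σ.toFun ![true, false])
    (σ.toFun ![false, true]) (σ.toFun ![true, true])
    (hadj _ _ ⟨0, by decide⟩) (hadj _ _ ⟨1, by decide⟩) (hadj _ _ ⟨1, by decide⟩)
    (hadj _ _ ⟨0, by decide⟩)
  have h' := congrArg (Int.cast : ℤ → R) h
  push_cast at h'
  have hface0 : ∀ e f : Bool, (σ.face 0 e).toFun (fun _ => f) = σ.toFun ![e, f] := fun e f =>
    congrArg σ.toFun (hf e f)
  have hface1 : ∀ e f : Bool, (σ.face 1 e).toFun (fun _ => f) = σ.toFun ![f, e] := fun e f =>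
    congrArg σ.toFun (hf' e f)
  rw [LinearMap.comp_apply, cubeBoundary_chainOf, Fin.sum_univ_two]
  simp only [map_add, map_smul, map_sub, pentagonCochain_chainOf, hface0, hface1, Fin.val_zero,
    Fin.val_one, smul_eq_mul, LinearMap.zero_apply]
  linear_combination h'

theorem nontrivial_cubeHomology_pentagon [Nontrivial R] :
    Nontrivial (cubeHomology R (SimpleGraph.cycleGraph 5) 1) := by
  have hadj : ∀ i : Fin 5, (SimpleGraph.cycleGraph 5).Adj i (i + 1) := fun i =>
    Or.inr (add_sub_cancel_left i 1)
  refine nontrivial_cubeHomology_succ R (z := ∑ i, chainOf R (edgeCube (hadj i))) ?_ ?_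
  · simp only [map_sum, cubeBoundary_edgeCube, Finset.sum_sub_distrib]
    rw [sub_eq_zero]
    -- Rotation by 1 permutes the vertices, so start points and end points have equal sums.
    exact Equiv.sum_comp (Equiv.addRight (1 : Fin 5))
      fun i => chainOf R (pointCube (SimpleGraph.cycleGraph 5) i)
  · rintro ⟨y, hy⟩
    have h := pentagonCochain_cubeBoundary R y
    rw [hy] at h
    -- Only the edge from `4` to `0` contributes, so the cochain takes the value 1.
    simp [pentagonCochain, edgeCube, Fin.sum_univ_five, pentagonCrossing] at h

end Pentagon

theorem nonempty_cubeHomology_graphSeq_equiv (R : Type v) [CommRing R] (V : Type u)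
    (G : SimpleGraph V) (d : ℕ) :
    Nonempty (cubeHomology R (graphSeq G (d + 2)).2 (d + 2) ≃ₗ[R]
      cubeHomology R (graphSeq G (d + 1)).2 (d + 1)) :=
  -- The length `(d + 1) + 3` is exactly the bound `d + 4`.
  nonempty_cubeHomology_suspension_equiv R (graphSeq G (d + 1)).2 d le_rfl

/-- For every simple graph `G` and every commutative ring `R`, the cubical homology of `G_{d+1}` in
degree `d + 1` is isomorphic to that of `G_d` in degree `d`, for all `d ≥ 1`; for `G_1` the
pentagon and `R ≠ 0`, the homology of `G_d` in degree `d` is nonzero for all `d ≥ 1`, and that of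
the pentagon in degree `0` is nonzero. -/
theorem theorem5p2 (R : Type v) [CommRing R] :
    (∀ (V : Type u) (G : SimpleGraph V) (d : ℕ), 1 ≤ d →
      Nonempty (cubeHomology R (graphSeq G (d + 1)).2 (d + 1) ≃ₗ[R]
        cubeHomology R (graphSeq G d).2 d)) ∧
    (Nontrivial R →
      Nontrivial (cubeHomology R (SimpleGraph.cycleGraph 5) 0) ∧
      ∀ d : ℕ, 1 ≤ d →
        Nontrivial (cubeHomology R (graphSeq (SimpleGraph.cycleGraph 5) d).2 d)) := by
  refine ⟨fun V G d hd => ?_, fun _ => ⟨nontrivial_cubeHomology_zero R _, fun d hd => ?_⟩⟩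
  · obtain ⟨d, rfl⟩ := Nat.exists_eq_add_of_le' hd
    exact nonempty_cubeHomology_graphSeq_equiv R V G d
  · induction d, hd using Nat.le_induction with
    | base => exact nontrivial_cubeHomology_pentagon R
    | succ d hd ih =>
      obtain ⟨d, rfl⟩ := Nat.exists_eq_add_of_le' hd
      obtain ⟨e⟩ := nonempty_cubeHomology_graphSeq_equiv R _ (SimpleGraph.cycleGraph 5) d
      exact e.toEquiv.nontrivial
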